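/- Let $\omega$ be a non-principal ultrafilter on $\mathbb N$, let $p\in[1,\infty)$, and let $(X_i,d_i,e_i)_{i\in\mathbb N}$ be a sequence of pointed metric spaces. *Notation.* $X^\omega$ is the ultraproduct of the $X_i$, with hyperreal-valued distance $d^\omega([(x_i)],[(y_i)])=[(d_i(x_i,y_i))]\in\mathbb R^\omega$; $X^\omega_{\lim}$ is the set of $x\in X^\omega$ for which $d^\omega([(e_i)],x)$ is bounded by a standard real; $(\hat X,\hat d)$ is the metric ultralimit, i.e. the quotient of $X^\omega_{\lim}$ by the relation $d^\omega(x,y)\approx 0$, with $\hat d=\mathrm{st}(d^\omega)$; and $st_{\hat d}:X^\omega_{\lim}\to\hat X$ is the quotient map. For a metric space $Y$, $\mathcal P_p(Y)$ is the set of Radon probability measures on $Y$ with finite $p$-th moment, with the $p$-Wasserstein distance $W_p$. $\mathcal P_p(X)^\omega$ is the ultraproduct of the $\mathcal P_p(X_i)$, $W_p^\omega([(\mu_i)],[(\nu_i)])=[(W_p(\mu_i,\nu_i))]$, and $\mathcal P_p(X)^\omega_{\lim}$ is the set of elements of $\mathcal P_p(X)^\omega$ whose $W_p^\omega$-distance to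 $[(\delta_{e_i})]$ is bounded by a standard real. For $\mu^\omega=[(\mu_i)]\in\mathcal P_p(X)^\omega$, the Loeb measure $\mu_L$ is the Carathéodory extension of the premeasure $\prod_\omega B_i\mapsto \mathrm{st}[(\mu_i(B_i))]$ on the algebra of internal Borel subsets of $X^\omega$. The pushforward $\mu_L\circ st_{\hat d}^{-1}$ is well-defined if $st_{\hat d}^{-1}(B)$ is Loeb measurable (that is, $\mu_L$-measurable in the sense of Carathéodory) for every Borel set $B\subseteq\hat X$. Let $\iota$ be the canonical isometric embedding of $(\mathcal P_p(\hat X),W_p)$ into the metric ultralimit $(\widehat{\mathcal P_p(X)},\hat W_p)=(\mathcal P_p(X)^\omega_{\lim},\mathrm{st}\,W_p^\omega)/\!\approx$; it sends $\frac1N\sum_{j=1}^N\delta_{\hat x_j}$ with $\hat x_j=st_{\hat d}[(x_{j,i})_i]$ to the class of $\big[\big(\frac1N\sum_{j=1}^N\delta_{x_{j,i}}\big)_i\big]$, and is extended by density. A measure $\mu^\omega\in\mathcal P_p(X)^\omega_{\lim}$ is a lifting of $\mu\in\mathcal P_p(\hat X)$ if $\iota\mu$ is the class of $\mu^\omega$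 in $\widehat{\mathcal P_p(X)}$. *Statement.* (1) Let $\mu^\omega,\nu^\omega\in\mathcal P_p(X)^\omega$ satisfy $W_p^\omega(\mu^\omega,\nu^\omega)\approx 0$, with associated Loeb measures $\mu_L$ and $\nu_L$. If the pushforwards $\mu_L\circ st_{\hat d}^{-1}$ and $\nu_L\circ st_{\hat d}^{-1}$ are both well-defined and belong to $\mathcal P_p(\hat X)$, then they are equal. (2) Let $\mu^\omega\in\mathcal P_p(X)^\omega_{\lim}$ be a lifting of $\mu\in\mathcal P_p(\hat X)$, with associated Loeb measure $\mu_L$. If $\mu_L\circ st_{\hat d}^{-1}$ is well-defined and belongs to $\mathcal P_p(\hat X)$, then $\mu_L\circ st_{\hat d}^{-1}=\mu$. -/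

import Mathlib

open Filter MeasureTheory Topology
open scoped ENNReal

noncomputable section

namespace UltraWasserstein

/-! ### Ultraproducts, hyperreals, metric ultralimits -/

section Ultralimit

/-- The ultraproduct `X^ω = ∏ X_i / ω`: sequences modulo equality for `ω`-almost all indices. -/
abbrev UProd (ω : Ultrafilter ℕ) (X : ℕ → Type*) : Type _ :=
  Filter.Product (ω : Filter ℕ) X

/-- The class `[(x_i)]` of a sequence in the ultraproduct. -/
def UProd.mk (ω : Ultrafilter ℕ) {X : ℕ → Type*} (x : ∀ i, X i) : UProd ω X :=
  Quotient.mk (productSetoid (ω : Filter ℕ) X) x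

/-- The hyperreals `ℝ^ω`, the ultrapower of `ℝ`. -/
abbrev Hyper (ω : Ultrafilter ℕ) : Type := Germ (ω : Filter ℕ) ℝ

/-- The standard part of a (finite) hyperreal. -/
def st {ω : Ultrafilter ℕ} (r : Hyper ω) : ℝ := ArchimedeanClass.stdPart r

variable {ω : Ultrafilter ℕ} {X : ℕ → Type*} [∀ i, MetricSpace (X i)]

/-- The hyperreal-valued distance `d^ω([(x_i)], [(y_i)]) = [(d_i(x_i, y_i))]`. -/
def uDist (x y : UProd ω X) : Hyper ω :=
  Quotient.map₂ (sc := germSetoid (ω : Filter ℕ) ℝ)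
    (fun (x y : ∀ i, X i) (i : ℕ) => dist (x i) (y i))
    (fun _ _ hx _ _ hy => by
      filter_upwards [hx, hy] with i h₁ h₂
      rw [h₁, h₂]) x y

/-- A point of the ultraproduct is limited if its hyperreal distance to the origin
`[(e_i)]` is bounded by a standard number. -/
def IsLimited (e : ∀ i, X i) (x : UProd ω X) : Prop :=
  ∃ n : ℕ, uDist (UProd.mk ω e) x ≤ (n : Hyper ω)

variable (ω) in
/-- The limited part `X^ω_lim` of the ultraproduct. -/
def LimSpace (e : ∀ i, X i) : Type _ := {x : UProd ω X // IsLimited e x}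

theorem uDist_self (x : UProd ω X) : uDist x x = 0 := by
  induction x using Quotient.inductionOn with
  | h x => exact Quotient.sound (Eventually.of_forall fun i => dist_self (x i))

theorem uDist_comm (x y : UProd ω X) : uDist x y = uDist y x := by
  induction x, y using Quotient.inductionOn₂ with
  | h x y => exact Quotient.sound (Eventually.of_forall fun i => dist_comm (x i) (y i))

theorem uDist_nonneg (x y : UProd ω X) : 0 ≤ uDist x y := by
  induction x, y using Quotient.inductionOn₂ with
  | h x y => exact Germ.coe_le.2 (Eventually.of_forall fun i => dist_nonneg)

theorem uDist_triangle (x y z : UProd ω X) : uDist x z ≤ uDist x y + uDist y z := by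
  induction x, y, z using Quotient.inductionOn₃ with
  | h x y z =>
    exact Germ.coe_le.2 (Eventually.of_forall fun i => dist_triangle (x i) (y i) (z i))

theorem LimSpace.uDist_finite {e : ∀ i, X i} (x y : LimSpace ω e) :
    0 ≤ ArchimedeanClass.mk (uDist x.1 y.1) := by
  obtain ⟨m, hm⟩ := x.2
  obtain ⟨n, hn⟩ := y.2
  have h : uDist x.1 y.1 ≤ ((m + n : ℕ) : Hyper ω) := by
    push_cast
    refine (uDist_triangle x.1 (UProd.mk ω e) y.1).trans ?_
    rw [uDist_comm x.1]
    exact add_le_add hm hn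
  refine (ArchimedeanClass.mk_natCast_nonneg (m + n)).trans
    (ArchimedeanClass.mk_le_mk_of_abs ?_)
  rwa [abs_of_nonneg (uDist_nonneg _ _), abs_of_nonneg (by positivity)]

/-- On `X^ω_lim`, the standard part of `d^ω` is a pseudometric. -/
instance (e : ∀ i, X i) : PseudoMetricSpace (LimSpace ω e) where
  dist x y := st (uDist x.1 y.1)
  dist_self x := by
    change ArchimedeanClass.stdPart (uDist x.1 x.1) = 0
    rw [uDist_self, ArchimedeanClass.stdPart_zero]
  dist_comm x y := by
    rw [uDist_comm]
  dist_triangle x y z := by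
    change ArchimedeanClass.stdPart (uDist x.1 z.1) ≤
      ArchimedeanClass.stdPart (uDist x.1 y.1) + ArchimedeanClass.stdPart (uDist y.1 z.1)
    have h₁ := LimSpace.uDist_finite x y
    have h₂ := LimSpace.uDist_finite y z
    rw [← ArchimedeanClass.stdPart_add h₁ h₂]
    exact ArchimedeanClass.stdPart_monotoneOn (LimSpace.uDist_finite x z)
      ((le_min h₁ h₂).trans (ArchimedeanClass.min_le_mk_add _ _)) (uDist_triangle _ _ _)

variable (ω) in
/-- The metric ultralimit `(X̂, d̂)`: the quotient of `X^ω_lim` by `d^ω(x, y) ≈ 0`, with the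
distance `d̂([x], [y]) = st (d^ω(x, y))`. -/
def Ultralimit (e : ∀ i, X i) : Type _ := SeparationQuotient (LimSpace ω e)

instance (e : ∀ i, X i) : MetricSpace (Ultralimit ω e) :=
  inferInstanceAs (MetricSpace (SeparationQuotient (LimSpace ω e)))

instance (e : ∀ i, X i) : MeasurableSpace (Ultralimit ω e) := borel _

instance (e : ∀ i, X i) : BorelSpace (Ultralimit ω e) := ⟨rfl⟩

/-- The quotient map `st_d̂ : X^ω_lim → X̂`. -/
def stMap {e : ∀ i, X i} (x : LimSpace ω e) : Ultralimit ω e := SeparationQuotient.mk x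

end Ultralimit

/-! ### Wasserstein spaces of Radon measures -/

section Wasserstein

variable {Y : Type*} [MetricSpace Y] [MeasurableSpace Y] [BorelSpace Y]

/-- `𝒫_p(Y)`: Radon probability measures on `Y` with finite `p`-th moment. -/
def Pp (Y : Type*) [MetricSpace Y] [MeasurableSpace Y] [BorelSpace Y] (p : ℝ) :
    Set (Measure Y) :=
  {μ | IsProbabilityMeasure μ ∧ μ.InnerRegular ∧ ∃ y₀ : Y, ∫⁻ y, edist y₀ y ^ p ∂μ < ∞}

/-- The couplings of `μ` and `ν`. -/
def couplings (μ ν : Measure Y) : Set (Measure (Y × Y)) :=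
  {γ | γ.map Prod.fst = μ ∧ γ.map Prod.snd = ν}

/-- The `p`-Wasserstein distance. -/
def Wp (p : ℝ) (μ ν : Measure Y) : ℝ≥0∞ :=
  (⨅ γ ∈ couplings μ ν, ∫⁻ z, edist z.1 z.2 ^ p ∂γ) ^ (1 / p)

/-- The discrete measure `(1 / (N + 1)) ∑_j δ_{y_j}`. -/
def cloud {Y : Type*} [MeasurableSpace Y] {N : ℕ} (y : Fin (N + 1) → Y) : Measure Y :=
  ((N + 1 : ℕ) : ℝ≥0∞)⁻¹ • ∑ j, Measure.dirac (y j)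

end Wasserstein

/-! ### Internal measures -/

section Internal

variable {ω : Ultrafilter ℕ} {X : ℕ → Type*} [∀ i, MeasurableSpace (X i)]

variable (ω X) in
/-- Internal measures: the ultraproduct of the spaces of Borel measures on the `X_i`. -/
abbrev IMeasure : Type _ := UProd ω (fun i => Measure (X i))

/-- The internal set `∏_ω B_i ⊆ X^ω`: the classes `[(x_i)]` with `x_i ∈ B_i` `ω`-a.s. -/
def iSet (ω : Ultrafilter ℕ) {X : ℕ → Type*} (B : ∀ i, Set (X i)) : Set (UProd ω X) :=
  UProd.mk ω '' {x | ∀ᶠ i in (ω : Filter ℕ), x i ∈ B i}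

/-- The hyperreal `μ^ω(∏_ω B_i) = [(μ_i(B_i))]`, for `μ^ω = [(μ_i)]`. -/
def IMeasure.eval (μ : IMeasure ω X) (B : ∀ i, Set (X i)) : Hyper ω :=
  Quotient.map (sb := germSetoid (ω : Filter ℕ) ℝ)
    (fun (μ : ∀ i, Measure (X i)) (i : ℕ) => (μ i).real (B i))
    (fun _ _ h => by
      filter_upwards [h] with i hi
      rw [hi]) μ

/-- The premeasure `st ∘ μ^ω` on the algebra `ℬ^ω` of internal Borel sets `∏_ω B_i`, with value
`∞` on all other sets. (The infimum is over the representations `S = ∏_ω B_i`, and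
`st (μ^ω(S))` does not depend on the representation.) -/
def loebPremeasure (μ : IMeasure ω X) (S : Set (UProd ω X)) : ℝ≥0∞ :=
  ⨅ (B : ∀ i, Set (X i)) (_ : ∀ i, MeasurableSet (B i)) (_ : S = iSet ω B),
    ENNReal.ofReal (st (μ.eval B))

theorem loebPremeasure_empty (μ : IMeasure ω X) : loebPremeasure μ ∅ = 0 := by
  have hB : (∅ : Set (UProd ω X)) = iSet ω (fun i => (∅ : Set (X i))) := by
    have : {x : ∀ i, X i | ∀ᶠ i in (ω : Filter ℕ), x i ∈ (∅ : Set (X i))} = ∅ := by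
      ext x
      simp [NeBot.ne]
    rw [iSet, this, Set.image_empty]
  have h0 : μ.eval (fun i => (∅ : Set (X i))) = 0 := by
    induction μ using Quotient.inductionOn with
    | h μ => exact Quotient.sound (Eventually.of_forall fun i => measureReal_empty)
  refine le_antisymm ?_ bot_le
  refine (iInf_le_of_le (fun i => (∅ : Set (X i))) (iInf_le_of_le (fun _ => MeasurableSet.empty)
    (iInf_le _ hB))).trans ?_
  rw [h0, st, ArchimedeanClass.stdPart_zero, ENNReal.ofReal_zero]

/-- The Carathéodory outer measure of the premeasure `st ∘ μ^ω`. -/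
def loebOuter (μ : IMeasure ω X) : OuterMeasure (UProd ω X) :=
  OuterMeasure.ofFunction (loebPremeasure μ) (loebPremeasure_empty μ)

/-- The Loeb `σ`-algebra `L(ℬ^ω)` of `μ^ω`, as given by Carathéodory's theorem. -/
@[reducible]
def loebSpace (μ : IMeasure ω X) : MeasurableSpace (UProd ω X) := (loebOuter μ).caratheodory

/-- The Loeb measure `μ_L` of `μ^ω`. -/
def loebMeasure (μ : IMeasure ω X) : @Measure (UProd ω X) (loebSpace μ) :=
  @OuterMeasure.toMeasure _ (loebSpace μ) (loebOuter μ) le_rfl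

end Internal

section Pushforward

variable {ω : Ultrafilter ℕ} {X : ℕ → Type*} [∀ i, MetricSpace (X i)]
  [∀ i, MeasurableSpace (X i)] {e : ∀ i, X i}

/-- The preimage `st_d̂⁻¹(B) ⊆ X^ω_lim ⊆ X^ω` of a subset `B` of the metric ultralimit. -/
def stPreimage (B : Set (Ultralimit ω e)) : Set (UProd ω X) :=
  Subtype.val '' ((stMap : LimSpace ω e → Ultralimit ω e) ⁻¹' B)

/-- The pushforward `μ_L ∘ st_d̂⁻¹` is well-defined (preimages of Borel sets are Loeb
measurable) and equal to `ρ`. -/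
structure IsLoebPushforward (μ : IMeasure ω X) (ρ : Measure (Ultralimit ω e)) : Prop where
  measurable : ∀ B : Set (Ultralimit ω e), MeasurableSet B →
    MeasurableSet[loebSpace μ] (stPreimage B)
  eq : ∀ B : Set (Ultralimit ω e), MeasurableSet B → ρ B = loebMeasure μ (stPreimage B)

end Pushforward

/-! ### Ultraproducts of Wasserstein spaces and liftings -/

section Lifting

variable {ω : Ultrafilter ℕ} {X : ℕ → Type*} [∀ i, MetricSpace (X i)]
  [∀ i, MeasurableSpace (X i)] [∀ i, BorelSpace (X i)]

variable (ω X) in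
/-- The ultraproduct `𝒫_p(X)^ω` of the spaces `𝒫_p(X_i)`. -/
def internalPp (p : ℝ) : Set (IMeasure ω X) :=
  UProd.mk ω '' {μ | ∀ i, μ i ∈ Pp (X i) p}

/-- `W_p^ω([(μ_i)], [(ν_i)]) = [(W_p(μ_i, ν_i))]`. -/
def uWp (p : ℝ) (μ ν : IMeasure ω X) : Germ (ω : Filter ℕ) ℝ≥0∞ :=
  Quotient.map₂ (sc := germSetoid (ω : Filter ℕ) ℝ≥0∞)
    (fun (μ ν : ∀ i, Measure (X i)) (i : ℕ) => Wp p (μ i) (ν i))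
    (fun _ _ hμ _ _ hν => by
      filter_upwards [hμ, hν] with i h₁ h₂
      rw [h₁, h₂]) μ ν

/-- `μ^ω ≈ ν^ω` for `W_p^ω`: their distance is below every standard `ε > 0`. -/
def WpClose (p : ℝ) (μ ν : IMeasure ω X) : Prop :=
  ∀ ε : ℝ, 0 < ε → uWp p μ ν < ((ENNReal.ofReal ε : ℝ≥0∞) : Germ (ω : Filter ℕ) ℝ≥0∞)

/-- The limited part `𝒫_p(X)^ω_lim`: the elements of `𝒫_p(X)^ω` at a distance from
`[(δ_{e_i})]` that is bounded by a standard number. -/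
def limitedPp (e : ∀ i, X i) (p : ℝ) : Set (IMeasure ω X) :=
  {μ | μ ∈ internalPp ω X p ∧ ∃ R : ℝ,
    uWp p μ (UProd.mk ω fun i => Measure.dirac (e i)) ≤
      ((ENNReal.ofReal R : ℝ≥0∞) : Germ (ω : Filter ℕ) ℝ≥0∞)}

/-- `κ = (1/N) ∑_j δ_{x̂_j}` is a discrete measure on `X̂`, and `κ^ω = [((1/N) ∑_j δ_{x_{j,i}})_i]`
where `[(x_{j,i})_i] ∈ X^ω_lim` is a lifting of `x̂_j`. In terms of the canonical embedding `ι` of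
`𝒫_p(X̂)` into the metric ultralimit of the `𝒫_p(X_i)`: the point `ι κ` is the class of `κ^ω`. -/
def IsDiscreteLifting (e : ∀ i, X i) (κω : IMeasure ω X) (κ : Measure (Ultralimit ω e)) :
    Prop :=
  ∃ (N : ℕ) (xhat : Fin (N + 1) → Ultralimit ω e) (x : Fin (N + 1) → ∀ i, X i),
    (∀ j, UProd.mk ω (x j) ∈ stPreimage {xhat j}) ∧
    κ = cloud xhat ∧ κω = UProd.mk ω fun i => cloud fun j => x j i

/-- `μ^ω ∈ 𝒫_p(X)^ω_lim` is a lifting of `μ ∈ 𝒫_p(X̂)`, that is, `ι μ` is the class of `μ^ω`.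
The isometric embedding `ι` is given on discrete measures by `IsDiscreteLifting` and extended
to `𝒫_p(X̂)` by density. So `ι μ` is the class of `μ^ω` iff there are discrete measures `κ_n → μ`
in `W_p` with liftings `κ_n^ω` such that the classes of the `κ_n^ω` converge to that of `μ^ω` in
the metric `st ∘ W_p^ω`. -/
def IsWpLifting (e : ∀ i, X i) (p : ℝ) (μω : IMeasure ω X) (μ : Measure (Ultralimit ω e)) :
    Prop :=
  μω ∈ limitedPp e p ∧ μ ∈ Pp (Ultralimit ω e) p ∧
  ∃ (κ : ℕ → Measure (Ultralimit ω e)) (κω : ℕ → IMeasure ω X),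
    (∀ n, IsDiscreteLifting e (κω n) (κ n)) ∧
    Tendsto (fun n => Wp p (κ n) μ) atTop (𝓝 0) ∧
    ∀ ε : ℝ, 0 < ε → ∀ᶠ n in atTop,
      uWp p (κω n) μω < ((ENNReal.ofReal ε : ℝ≥0∞) : Germ (ω : Filter ℕ) ℝ≥0∞)

end Lifting

end UltraWasserstein

end

open UltraWasserstein

open UltraWasserstein

namespace UltraWasserstein

/-! Two Radon probability measures `μ`, `ν` agree as soon as `μ K + ν L ≤ 1` for all disjoint
compact `K`, `L` (`measure_eq_of_forall_disjoint_isCompact`), and this inequality survives passage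
to the ultraproduct.

Cover `K` and `L` by finitely many balls whose centres are far apart, and lift the centres to
sequences. For `ω`-almost every `i` the resulting unions of balls in `X i` are still separated by a
standard `r`, and they bound the Loeb pushforwards of `K` and `L` from above, up to `δ`. A coupling
of cost below `(r δ) ^ p` can move only mass `δ ^ p ≤ δ` across a gap `r`, so two measures that are
`W_p`-close give the two unions total mass at most `1 + δ` (`measure_add_measure_le_of_Wp_lt`). Let
`δ → 0`.

For a lifting, the second measure lives on the ultralimit itself. It is compared there with a nearby
discrete measure, whose atoms are then followed into `X i`. This uses the same transport estimate
twice: once in the ultralimit, once in `X i`. -/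

theorem le_one_of_forall_le_one_add {a : ℝ≥0∞}
    (h : ∀ δ : ℝ, 0 < δ → δ ≤ 1 → a ≤ 1 + 3 * ENNReal.ofReal δ) : a ≤ 1 := by
  have hlim : Tendsto (fun δ : ℝ => 1 + 3 * ENNReal.ofReal δ) (𝓝[>] 0)
      (𝓝 (1 + 3 * ENNReal.ofReal 0)) := by
    refine tendsto_const_nhds.add (ENNReal.Tendsto.const_mul ?_ (Or.inr (by simp)))
    exact (ENNReal.continuous_ofReal.tendsto 0).mono_left nhdsWithin_le_nhds
  rw [ENNReal.ofReal_zero, mul_zero, add_zero] at hlim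
  refine ge_of_tendsto hlim ?_
  filter_upwards [Ioc_mem_nhdsGT zero_lt_one] with δ hδ using h δ hδ.1 hδ.2

/-! ### Radon measures and couplings -/

theorem cloud_apply {Y : Type*} [MeasurableSpace Y] {N : ℕ} (y : Fin (N + 1) → Y)
    {A : Set Y} (hA : MeasurableSet A) :
    cloud y A = ((N + 1 : ℕ) : ℝ≥0∞)⁻¹ * ∑ j, A.indicator 1 (y j) := by
  simp [cloud, hA]

/-- Disjoint compact sets have finite nets whose points are uniformly far apart. -/
theorem exists_separated_nets {Y : Type*} [MetricSpace Y] {K L : Set Y}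
    (hK : IsCompact K) (hL : IsCompact L)
    (hKL : Disjoint K L) :
    ∃ r > 0, ∃ s t : Set Y, s.Finite ∧ t.Finite ∧
      K ⊆ ⋃ x ∈ s, Metric.ball x r ∧ L ⊆ ⋃ y ∈ t, Metric.ball y r ∧
      ∀ x ∈ s, ∀ y ∈ t, 4 * r < dist x y := by
  obtain ⟨r, hr, h⟩ := Metric.exists_pos_forall_lt_edist hK hL.isClosed hKL
  have hr4 : (0 : ℝ) < r / 4 := by positivity
  obtain ⟨s, hsK, hs, hcs⟩ := hK.finite_cover_balls hr4
  obtain ⟨t, htL, ht, hct⟩ := hL.finite_cover_balls hr4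
  refine ⟨r / 4, hr4, s, t, hs, ht, hcs, hct, fun x hx y hy => ?_⟩
  have := h x (hsK hx) y (htL hy)
  rw [edist_nndist, ENNReal.coe_lt_coe, ← NNReal.coe_lt_coe, coe_nndist] at this
  linarith

/-- Exhausting `Kᶜ` by compact sets `L` gives `ν Kᶜ ≤ 1 - μ K`, so `μ K ≤ ν K` for compact `K`.
Inner regularity of `μ` extends this to `μ ≤ ν`, and equal total mass forces equality. -/
theorem measure_eq_of_forall_disjoint_isCompact {Y : Type*} [MetricSpace Y] [MeasurableSpace Y]
    [BorelSpace Y] {μ ν : Measure Y} [IsProbabilityMeasure μ] [IsProbabilityMeasure ν]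
    (hμ : μ.InnerRegular) (hν : ν.InnerRegular)
    (h : ∀ K L : Set Y, IsCompact K → IsCompact L → Disjoint K L → μ K + ν L ≤ 1) : μ = ν := by
  refine Measure.eq_of_le_of_isProbabilityMeasure (Measure.le_iff.2 fun s hs => ?_)
  rw [hs.measure_eq_iSup_isCompact μ]
  refine iSup_le fun K => iSup_le fun hKs => iSup_le fun hK => le_trans ?_ (measure_mono hKs)
  have hKm := hK.measurableSet
  have hc : ν Kᶜ ≤ 1 - μ K := by
    rw [hKm.compl.measure_eq_iSup_isCompact ν]
    refine iSup_le fun L => iSup_le fun hL => iSup_le fun hLc => ?_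
    refine ENNReal.le_sub_of_add_le_left (measure_ne_top _ _) (h K L hK hLc ?_)
    exact disjoint_compl_right.mono_right hL
  have hsum : ν K + ν Kᶜ = 1 := by rw [measure_add_measure_compl hKm, measure_univ]
  have h1 : 1 ≤ ν K + (1 - μ K) := hsum.ge.trans (by gcongr)
  have h2 : μ K + (1 - μ K) = 1 := add_tsub_cancel_of_le prob_le_one
  have h3 : (1 - μ K) ≠ ∞ := ne_top_of_le_ne_top ENNReal.one_ne_top tsub_le_self
  exact (ENNReal.add_le_add_iff_right h3).1 (h2.le.trans h1)

/-- For a coupling `γ`, the excess of `μ A + ν B` over `1` is at most `γ (A × B)`, where the cost is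
at least `r ^ p`; Markov's inequality bounds this mass. -/
theorem measure_add_measure_le_of_Wp_lt {Y : Type*} [MetricSpace Y] [MeasurableSpace Y]
    {p : ℝ} (hp : 1 ≤ p) {μ ν : Measure Y} [IsProbabilityMeasure ν] {A B : Set Y}
    (hA : MeasurableSet A) (hB : MeasurableSet B)
    {r δ : ℝ} (hr : 0 < r) (hδ1 : δ ≤ 1)
    (hW : Wp p μ ν < ENNReal.ofReal (r * δ)) (hsep : ∀ a ∈ A, ∀ b ∈ B, r ≤ dist a b) :
    μ A + ν B ≤ 1 + ENNReal.ofReal δ := by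
  have hp0 : 0 < p := zero_lt_one.trans_le hp
  have hW' : ⨅ γ ∈ couplings μ ν, ∫⁻ z, edist z.1 z.2 ^ p ∂γ < ENNReal.ofReal (r * δ) ^ p := by
    have := ENNReal.rpow_lt_rpow hW hp0
    rwa [Wp, ← ENNReal.rpow_mul, one_div_mul_cancel hp0.ne', ENNReal.rpow_one] at this
  simp only [iInf_lt_iff] at hW'
  obtain ⟨γ, ⟨h₁, h₂⟩, hγ⟩ := hW'
  have hAγ : μ A = γ (Prod.fst ⁻¹' A) := by rw [← h₁, Measure.map_apply measurable_fst hA]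
  have hBγ : ν B = γ (Prod.snd ⁻¹' B) := by rw [← h₂, Measure.map_apply measurable_snd hB]
  have huniv : γ Set.univ = 1 := by
    rw [← measure_univ (μ := ν), ← h₂, Measure.map_apply measurable_snd .univ, Set.preimage_univ]
  have hBm : MeasurableSet (Prod.snd ⁻¹' B : Set (Y × Y)) := measurable_snd hB
  have hAm : MeasurableSet (Prod.fst ⁻¹' A : Set (Y × Y)) := measurable_fst hA
  rw [hAγ, hBγ, ← measure_union_add_inter _ hBm]
  refine add_le_add ((measure_mono (Set.subset_univ _)).trans huniv.le) ?_
  have hr0 : ENNReal.ofReal r ^ p ≠ 0 :=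
    (ENNReal.rpow_pos (ENNReal.ofReal_pos.2 hr) ENNReal.ofReal_ne_top).ne'
  have hrt : ENNReal.ofReal r ^ p ≠ ∞ := ENNReal.rpow_ne_top_of_nonneg hp0.le ENNReal.ofReal_ne_top
  have hmarkov : ENNReal.ofReal r ^ p * γ (Prod.fst ⁻¹' A ∩ Prod.snd ⁻¹' B) ≤
      ENNReal.ofReal r ^ p * ENNReal.ofReal δ ^ p := by
    rw [← ENNReal.mul_rpow_of_nonneg _ _ hp0.le, ← ENNReal.ofReal_mul hr.le]
    refine le_trans ?_ hγ.le
    rw [← lintegral_indicator_const (hAm.inter hBm)]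
    refine lintegral_mono (Set.indicator_le fun z hz => ?_)
    refine ENNReal.rpow_le_rpow ?_ hp0.le
    rw [edist_dist]
    exact ENNReal.ofReal_le_ofReal (hsep _ hz.1 _ hz.2)
  refine ((ENNReal.mul_le_mul_iff_right hr0 hrt).1 hmarkov).trans ?_
  calc ENNReal.ofReal δ ^ p ≤ ENNReal.ofReal δ ^ (1 : ℝ) :=
        ENNReal.rpow_le_rpow_of_exponent_ge (by simpa using ENNReal.ofReal_le_ofReal hδ1) hp
    _ = ENNReal.ofReal δ := ENNReal.rpow_one _

theorem cloud_le_cloud {Y Z : Type*} [MeasurableSpace Y] [MeasurableSpace Z] {N : ℕ}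
    {y : Fin (N + 1) → Y} {z : Fin (N + 1) → Z} {A : Set Y} {B : Set Z} (hA : MeasurableSet A)
    (hB : MeasurableSet B) (h : ∀ j, y j ∈ A → z j ∈ B) : cloud y A ≤ cloud z B := by
  rw [cloud_apply y hA, cloud_apply z hB]
  gcongr with j
  by_cases hj : y j ∈ A <;> simp [hj, h]

/-! ### Standard parts -/

section StandardPart

variable {ω : Ultrafilter ℕ}

variable (ω) in
/-- The standard reals inside the hyperreals. -/
def realEmbedding : ℝ →+*o Hyper ω where
  toFun r := ((r : ℝ) : Hyper ω)
  map_one' := rfl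
  map_mul' _ _ := rfl
  map_zero' := rfl
  map_add' _ _ := rfl
  monotone' _ _ h := Germ.const_le h

/-- No finiteness of the germ is needed: the standard part of an infinite hyperreal is `0` by
convention, and `f` is nonnegative. -/
theorem eventually_le_add_of_stdPart {f : ℕ → ℝ} (hf : ∀ i, 0 ≤ f i) {ε : ℝ} (hε : 0 < ε) :
    ∀ᶠ i in (ω : Filter ℕ), ArchimedeanClass.stdPart ((f : ℕ → ℝ) : Hyper ω) ≤ f i + ε := by
  by_cases h : 0 ≤ ArchimedeanClass.mk ((f : ℕ → ℝ) : Hyper ω)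
  · have := ArchimedeanClass.lt_of_lt_stdPart (realEmbedding ω) h (sub_lt_self _ hε)
    filter_upwards [Germ.coe_lt.1 this] with i hi
    linarith
  · rw [ArchimedeanClass.stdPart_eq_zero.2 (fun h0 => h h0.ge)]
    exact Eventually.of_forall fun i => add_nonneg (hf i) hε.le

end StandardPart

/-! ### Distances in the ultralimit and in the spaces `X i` -/

section Ultralimit

variable {ω : Ultrafilter ℕ} {X : ℕ → Type*} [∀ i, MetricSpace (X i)] {e : ∀ i, X i}

theorem exists_mk_mem_stPreimage (x : Ultralimit ω e) :
    ∃ a : ∀ i, X i, UProd.mk ω a ∈ stPreimage {x} := by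
  obtain ⟨⟨u, hu⟩, rfl⟩ := SeparationQuotient.surjective_mk x
  induction u using Quotient.inductionOn with
  | h a => exact ⟨a, ⟨_, hu⟩, rfl, rfl⟩

theorem dist_eq_stdPart {x y : Ultralimit ω e} {a b : ∀ i, X i}
    (ha : UProd.mk ω a ∈ stPreimage {x}) (hb : UProd.mk ω b ∈ stPreimage {y}) :
    0 ≤ ArchimedeanClass.mk (((fun i => dist (a i) (b i) : ℕ → ℝ)) : Hyper ω) ∧
      dist x y = ArchimedeanClass.stdPart (((fun i => dist (a i) (b i) : ℕ → ℝ)) : Hyper ω) := by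
  obtain ⟨u, rfl, hu⟩ := ha
  obtain ⟨v, rfl, hv⟩ := hb
  have h := LimSpace.uDist_finite u v
  have hd : dist (stMap u) (stMap v) = ArchimedeanClass.stdPart (uDist u.1 v.1) := rfl
  rw [hu, hv] at h hd
  exact ⟨h, hd⟩

theorem eventually_dist_lt {x y : Ultralimit ω e} {a b : ∀ i, X i}
    (ha : UProd.mk ω a ∈ stPreimage {x}) (hb : UProd.mk ω b ∈ stPreimage {y}) {c : ℝ}
    (h : dist x y < c) : ∀ᶠ i in (ω : Filter ℕ), dist (a i) (b i) < c := by
  obtain ⟨hfin, hd⟩ := dist_eq_stdPart ha hb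
  exact Germ.coe_lt.1 (ArchimedeanClass.lt_of_stdPart_lt (realEmbedding ω) hfin (hd ▸ h))

theorem eventually_lt_dist {x y : Ultralimit ω e} {a b : ∀ i, X i}
    (ha : UProd.mk ω a ∈ stPreimage {x}) (hb : UProd.mk ω b ∈ stPreimage {y}) {c : ℝ}
    (h : c < dist x y) : ∀ᶠ i in (ω : Filter ℕ), c < dist (a i) (b i) := by
  obtain ⟨hfin, hd⟩ := dist_eq_stdPart ha hb
  exact Germ.coe_lt.1 (ArchimedeanClass.lt_of_lt_stdPart (realEmbedding ω) hfin (hd ▸ h))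

/-- A choice of liftings of the points of the ultralimit. -/
noncomputable def lift (x : Ultralimit ω e) : ∀ i, X i := (exists_mk_mem_stPreimage x).choose

theorem mk_lift_mem (x : Ultralimit ω e) : UProd.mk ω (lift x) ∈ stPreimage {x} :=
  (exists_mk_mem_stPreimage x).choose_spec

/-- The union of the balls of radius `r` about the `i`-th coordinates of the points of `s`. -/
def ballUnion (s : Set (Ultralimit ω e)) (r : ℝ) (i : ℕ) : Set (X i) :=
  ⋃ x ∈ s, Metric.ball (lift x i) r

theorem isOpen_ballUnion (s : Set (Ultralimit ω e)) (r : ℝ) (i : ℕ) :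
    IsOpen (ballUnion s r i) :=
  isOpen_biUnion fun _ _ => Metric.isOpen_ball

theorem eventually_mem_ballUnion {s : Set (Ultralimit ω e)} {r : ℝ} {z : Ultralimit ω e}
    (hz : z ∈ ⋃ x ∈ s, Metric.ball x r) {a : ∀ i, X i} (ha : UProd.mk ω a ∈ stPreimage {z}) :
    ∀ᶠ i in (ω : Filter ℕ), a i ∈ ballUnion s r i := by
  simp only [Set.mem_iUnion, Metric.mem_ball] at hz
  obtain ⟨x, hx, hzx⟩ := hz
  filter_upwards [eventually_dist_lt ha (mk_lift_mem x) hzx] with i hi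
  exact Set.mem_biUnion hx hi

/-- Finiteness of `s` and `t` lets one `ω`-large set of indices serve all pairs of centres; the rest
is the triangle inequality. -/
theorem eventually_ballUnion_separated {s t : Set (Ultralimit ω e)} (hs : s.Finite)
    (ht : t.Finite) {r r' c : ℝ} (h : ∀ x ∈ s, ∀ y ∈ t, r + r' + c < dist x y) :
    ∀ᶠ i in (ω : Filter ℕ), ∀ a ∈ ballUnion s r i, ∀ b ∈ ballUnion t r' i, c ≤ dist a b := by
  have : ∀ᶠ i in (ω : Filter ℕ), ∀ x ∈ s, ∀ y ∈ t, r + r' + c < dist (lift x i) (lift y i) :=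
    (eventually_all_finite hs).2 fun x hx => (eventually_all_finite ht).2 fun y hy =>
      eventually_lt_dist (mk_lift_mem x) (mk_lift_mem y) (h x hx y hy)
  filter_upwards [this] with i hi a ha b hb
  simp only [ballUnion, Set.mem_iUnion, Metric.mem_ball] at ha hb
  obtain ⟨x, hx, hax⟩ := ha
  obtain ⟨y, hy, hby⟩ := hb
  have h₁ := hi x hx y hy
  have h₂ := dist_triangle4 (lift x i) a b (lift y i)
  rw [dist_comm (lift x i) a] at h₂
  linarith

end Ultralimit

/-! ### Pushforwards of Loeb measures -/

section Pushforward

variable {ω : Ultrafilter ℕ} {X : ℕ → Type*} [∀ i, MetricSpace (X i)]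
  [∀ i, MeasurableSpace (X i)] {e : ∀ i, X i}

theorem IsLoebPushforward.le_stdPart {μ : ∀ i, Measure (X i)} {ρ : Measure (Ultralimit ω e)}
    (h : IsLoebPushforward (UProd.mk ω μ) ρ) {K : Set (Ultralimit ω e)} (hK : MeasurableSet K)
    {B : ∀ i, Set (X i)} (hB : ∀ i, MeasurableSet (B i)) (hKB : stPreimage K ⊆ iSet ω B) :
    ρ K ≤ ENNReal.ofReal
      (ArchimedeanClass.stdPart (((fun i => (μ i).real (B i) : ℕ → ℝ)) : Hyper ω)) := by
  -- Only the inequality between the outer measure and its premeasure is used, not that they agree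
  -- on internal sets.
  rw [h.eq K hK, loebMeasure, @toMeasure_apply _ (loebSpace _) _ _ _ (h.measurable K hK)]
  refine (measure_mono hKB).trans ((OuterMeasure.ofFunction_le _).trans ?_)
  exact iInf_le_of_le B (iInf_le_of_le hB (iInf_le _ rfl))

variable [∀ i, BorelSpace (X i)]

theorem IsLoebPushforward.eventually_le {μ : ∀ i, Measure (X i)} {ρ : Measure (Ultralimit ω e)}
    (h : IsLoebPushforward (UProd.mk ω μ) ρ) {K : Set (Ultralimit ω e)} (hK : MeasurableSet K)
    {s : Set (Ultralimit ω e)} {r : ℝ} (hKs : K ⊆ ⋃ x ∈ s, Metric.ball x r) {ε : ℝ}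
    (hε : 0 < ε) :
    ∀ᶠ i in (ω : Filter ℕ), ρ K ≤ μ i (ballUnion s r i) + ENNReal.ofReal ε := by
  have hsub : stPreimage K ⊆ iSet ω (ballUnion s r) := by
    rintro _ ⟨⟨u, hu⟩, huK, rfl⟩
    induction u using Quotient.inductionOn with
    | h a => exact ⟨a, eventually_mem_ballUnion (hKs huK) ⟨_, rfl, rfl⟩, rfl⟩
  have hle := h.le_stdPart hK (fun i => (isOpen_ballUnion s r i).measurableSet) hsub
  filter_upwards [eventually_le_add_of_stdPart (f := fun i => (μ i).real (ballUnion s r i))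
    (fun i => measureReal_nonneg) hε] with i hi
  refine hle.trans ((ENNReal.ofReal_le_ofReal hi).trans (ENNReal.ofReal_add_le.trans ?_))
  gcongr
  exact ENNReal.ofReal_toReal_le

/-- Pushforwards of the Loeb measures of two infinitely close internal measures agree. -/
theorem IsLoebPushforward.eq_of_WpClose {p : ℝ} (hp : 1 ≤ p) {μω νω : IMeasure ω X}
    (hνω : νω ∈ internalPp ω X p) (hW : WpClose p μω νω)
    {μ ν : Measure (Ultralimit ω e)} (hμ : μ ∈ Pp (Ultralimit ω e) p)
    (hν : ν ∈ Pp (Ultralimit ω e) p) (hμL : IsLoebPushforward μω μ)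
    (hνL : IsLoebPushforward νω ν) : μ = ν := by
  obtain ⟨ν', hν', rfl⟩ := hνω
  induction μω using Quotient.inductionOn with
  | h μ' =>
  obtain ⟨hμ₁, hμ₂, -⟩ := hμ
  obtain ⟨hν₁, hν₂, -⟩ := hν
  refine measure_eq_of_forall_disjoint_isCompact hμ₂ hν₂ fun K L hK hL hKL => ?_
  obtain ⟨r, hr, s, t, hs, ht, hKs, hLt, hst⟩ := exists_separated_nets hK hL hKL
  refine le_one_of_forall_le_one_add fun δ hδ hδ1 => ?_
  have hsep := eventually_ballUnion_separated (r := r) (r' := r) (c := r) hs ht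
    fun x hx y hy => by linarith [hst x hx y hy]
  have hclose := Germ.coe_lt.1 (hW (r * δ) (mul_pos hr hδ))
  obtain ⟨i, h₁, h₂, h₃, h₄⟩ := ((hμL.eventually_le hK.measurableSet hKs hδ).and
    ((hνL.eventually_le hL.measurableSet hLt hδ).and (hsep.and hclose))).exists
  have := (hν' i).1
  have h₅ := measure_add_measure_le_of_Wp_lt hp (isOpen_ballUnion s r i).measurableSet
    (isOpen_ballUnion t r i).measurableSet hr hδ1 h₄ h₃
  calc μ K + ν L ≤ (μ' i (ballUnion s r i) + ENNReal.ofReal δ) +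
        (ν' i (ballUnion t r i) + ENNReal.ofReal δ) := add_le_add h₁ h₂
    _ = (μ' i (ballUnion s r i) + ν' i (ballUnion t r i)) + 2 * ENNReal.ofReal δ := by ring
    _ ≤ (1 + ENNReal.ofReal δ) + 2 * ENNReal.ofReal δ := by gcongr
    _ = 1 + 3 * ENNReal.ofReal δ := by ring

/-- The pushforward of the Loeb measure of a lifting of `μ` is `μ`. -/
theorem IsLoebPushforward.eq_of_isWpLifting {p : ℝ} (hp : 1 ≤ p) {μω : IMeasure ω X}
    {μ ρ : Measure (Ultralimit ω e)} (h : IsWpLifting e p μω μ)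
    (hρ : ρ ∈ Pp (Ultralimit ω e) p) (hρL : IsLoebPushforward μω ρ) : ρ = μ := by
  obtain ⟨⟨⟨μ', hμ', rfl⟩, -⟩, ⟨hμ₁, hμ₂, -⟩, κ, κω, hκ, hκμ, hκω⟩ := h
  obtain ⟨hρ₁, hρ₂, -⟩ := hρ
  refine measure_eq_of_forall_disjoint_isCompact hρ₂ hμ₂ fun K L hK hL hKL => ?_
  obtain ⟨r, hr, s, t, hs, ht, hKs, hLt, hst⟩ := exists_separated_nets hK hL hKL
  refine le_one_of_forall_le_one_add fun δ hδ hδ1 => ?_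
  have hrδ := mul_pos hr hδ
  obtain ⟨n, hn₁, hn₂⟩ := ((hκμ.eventually_lt_const (ENNReal.ofReal_pos.2 hrδ)).and
    (hκω (r * δ) hrδ)).exists
  obtain ⟨N, xhat, x, hx, hκn, hκωn⟩ := hκ n
  rw [hκn] at hn₁
  rw [hκωn] at hn₂
  -- Points outside `T` are at distance at least `r` from `L`, so the discrete measure gives `T` at
  -- least `μ L - δ`.
  set T := Metric.thickening r L with hT
  have hTm : MeasurableSet T := Metric.isOpen_thickening.measurableSet
  have hLT : cloud xhat Tᶜ + μ L ≤ 1 + ENNReal.ofReal δ := by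
    refine measure_add_measure_le_of_Wp_lt hp hTm.compl hL.measurableSet hr hδ1 hn₁ ?_
    intro a ha b hb
    by_contra! hab
    exact ha (Metric.mem_thickening_iff.2 ⟨b, hb, hab⟩)
  have hcloud : cloud xhat T + cloud xhat Tᶜ = 1 := by
    rw [measure_add_measure_compl hTm, cloud_apply xhat .univ]
    simp [ENNReal.inv_mul_cancel]
  have hLT' : μ L ≤ cloud xhat T + ENNReal.ofReal δ := by
    have hfin : cloud xhat Tᶜ ≠ ∞ :=
      ne_top_of_le_ne_top ENNReal.one_ne_top (hcloud ▸ le_add_self)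
    refine (ENNReal.add_le_add_iff_left hfin).1 (hLT.trans (le_of_eq ?_))
    rw [← hcloud]
    ring
  have hTt : T ⊆ ⋃ y ∈ t, Metric.ball y (2 * r) := by
    intro z hz
    obtain ⟨w, hw, hzw⟩ := Metric.mem_thickening_iff.1 hz
    have hwt := hLt hw
    simp only [Set.mem_iUnion, Metric.mem_ball] at hwt ⊢
    obtain ⟨y, hy, hwy⟩ := hwt
    exact ⟨y, hy, by linarith [dist_triangle z w y]⟩
  have hatoms : ∀ᶠ i in (ω : Filter ℕ), ∀ j, xhat j ∈ T → x j i ∈ ballUnion t (2 * r) i :=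
    eventually_all.2 fun j => by
      by_cases hj : xhat j ∈ T
      · filter_upwards [eventually_mem_ballUnion (hTt hj) (hx j)] with i hi _ using hi
      · exact Eventually.of_forall fun i hj' => absurd hj' hj
  -- The thickening doubles the radius on the side of `L`: `2 * r + r + r` uses up exactly the gap
  -- `4 * r` between the nets.
  have hsep := eventually_ballUnion_separated (r := 2 * r) (r' := r) (c := r) ht hs
    fun y hy x hx => by linarith [hst x hx y hy, dist_comm x y]
  obtain ⟨i, h₁, h₂, h₃, h₄⟩ := ((hρL.eventually_le hK.measurableSet hKs hδ).and
    (hatoms.and (hsep.and (Germ.coe_lt.1 hn₂)))).exists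
  have := (hμ' i).1
  have hBm := (isOpen_ballUnion s r i).measurableSet
  have hCm := (isOpen_ballUnion t (2 * r) i).measurableSet
  have h₅ := measure_add_measure_le_of_Wp_lt hp hCm hBm hr hδ1 h₄ h₃
  have h₆ := cloud_le_cloud (z := fun j => x j i) hTm hCm h₂
  calc ρ K + μ L ≤ (μ' i (ballUnion s r i) + ENNReal.ofReal δ) +
        (cloud (fun j => x j i) (ballUnion t (2 * r) i) + ENNReal.ofReal δ) :=
        add_le_add h₁ (hLT'.trans (by gcongr))
    _ = (cloud (fun j => x j i) (ballUnion t (2 * r) i) + μ' i (ballUnion s r i)) +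
        2 * ENNReal.ofReal δ := by ring
    _ ≤ (1 + ENNReal.ofReal δ) + 2 * ENNReal.ofReal δ := by gcongr
    _ = 1 + 3 * ENNReal.ofReal δ := by ring

end Pushforward

end UltraWasserstein

theorem mainTheorem4 (ω : Ultrafilter ℕ) (hω : (ω : Filter ℕ) ≤ Filter.cofinite)
    {X : ℕ → Type*} [∀ i, MetricSpace (X i)] [∀ i, MeasurableSpace (X i)]
    [∀ i, BorelSpace (X i)] (e : ∀ i, X i) (p : ℝ) (hp : 1 ≤ p) :
    (∀ μω ∈ internalPp ω X p, ∀ νω ∈ internalPp ω X p, WpClose p μω νω →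
      ∀ μ ∈ Pp (Ultralimit ω e) p, ∀ ν ∈ Pp (Ultralimit ω e) p,
        IsLoebPushforward μω μ → IsLoebPushforward νω ν → μ = ν) ∧
    (∀ (μω : IMeasure ω X) (μ : Measure (Ultralimit ω e)), IsWpLifting e p μω μ →
      ∀ ρ ∈ Pp (Ultralimit ω e) p, IsLoebPushforward μω ρ → ρ = μ) :=
  ⟨fun _ _ _ hνω hW _ hμ _ hν hμL hνL => hμL.eq_of_WpClose hp hνω hW hμ hν hνL,
    fun _ _ h _ hρ hρL => hρL.eq_of_isWpLifting hp h hρ⟩
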